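/- A directed or undirected graph on the vertex set $\{0,\dots,n-1\}$, $n\ge 1$, is given by its adjacency matrix $M\in\{0,1\}^{n\times n}$ (symmetric if the graph is undirected), which a quantum algorithm accesses by queries $|i,j,b\rangle\mapsto|i,j,b\oplus M_{ij}\rangle$. Quantum algorithms may measure and choose their further steps adaptively; only queries are counted. Let $m$ be the number of one-entries of $M$, and suppose $m$ is known. Consider the following algorithm. Start with an empty list $L$ and the zero matrix $M'\in\{0,1\}^{n\times n}$. For $t=m,m-1,\dots,1$, repeat a Grover search for a pair $(i,j)$ with $M_{ij}=1$ and $M'_{ij}=0$ until one is found, where each search uses the number of Grover iterations $\lfloor \pi/(4\arcsin\sqrt{t/n^2})\rfloor$ for the known number $t$ of solutions among $n^2$ pairs and checks the measured pair by one further query; then add $(i,j)$ to $L$ and set $M'_{ij}=1$. Finally decide classically, from $L$ alone, by building spanning trees, whether for every pair $(s,t)$ of vertices there is a path from $s$ to $t$ (connectivity for undirected graphs, strong connectivity for directed ones). Stopping the algorithm at a budget of $B$ queries means that it gives up, without a result, as soon as the next search would exceed $B$ queries in total. There is an absolute constant $C>0$ such that the following holds. 1. For every $n\ge1$ and every $M$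 with $m$ one-entries, the expected number of queries of the algorithm is at most $C\,n\sum_{x=1}^m x^{-1/2}$ and at most $C\,n\sqrt m$. The probability that the algorithm stopped at budget $B$ learns $M$ tends to $1$ as $B\to\infty$. For every $B$, the stopped algorithm makes at most $B$ queries and never gives a wrong result (neither a wrong matrix nor a wrong answer on connectivity). If $B$ is at least twice the expected number of queries, rounded down, it learns $M$, and gives the right answer on connectivity, with probability at least $1/2$. 2. For all $n\ge1$ and $m$ there is a budget $B\le C\,n\sqrt m$ such that, for every $M$ with $m$ one-entries, the algorithm stopped at budget $B$ learns $M$, and gives the right answer on connectivity, with probability at least $1/2$. 3. For all $n\ge1$ and $k$ there is a quantum query algorithm with at most $C\,n\sqrt{nk}=C\,n^{3/2}\sqrt k$ queries in the worst case that, for every graph on $n$ vertices all of whose vertices have out-degree $k$ (so that $m=nk$), decides (strong) connectivity with probability at least $2/3$ of a correct answer. -/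

import Mathlib

/-! Quantum query algorithms for graphs in the adjacency matrix model. -/

/-- Computational basis of the register: a query index `(i, j)`, a target bit, and a workspace
with basis `A`. -/
abbrev QBasis (n : ℕ) (A : Type) : Type := Fin n × Fin n × Bool × A

/-- (Unnormalised) pure states of the register. -/
abbrev QState (n : ℕ) (A : Type) : Type := EuclideanSpace ℂ (QBasis n A)

/-- The involution `|i, j, b, a⟩ ↦ |i, j, b ⊕ M i j, a⟩` of the basis. -/
def queryPerm {n : ℕ} {A : Type} (M : Matrix (Fin n) (Fin n) Bool) :
    Equiv.Perm (QBasis n A) where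
  toFun x := (x.1, x.2.1, xor x.2.2.1 (M x.1 x.2.1), x.2.2.2)
  invFun x := (x.1, x.2.1, xor x.2.2.1 (M x.1 x.2.1), x.2.2.2)
  left_inv x := by simp
  right_inv x := by simp

/-- The unitary `|i, j, b, a⟩ ↦ |i, j, b ⊕ M i j, a⟩`. -/
noncomputable def queryUnitary {n : ℕ} {A : Type} [Fintype A]
    (M : Matrix (Fin n) (Fin n) Bool) : QState n A ≃ₗᵢ[ℂ] QState n A :=
  LinearIsometryEquiv.piLpCongrLeft 2 ℂ ℂ (queryPerm M)

/-- Adaptive quantum query algorithms with outputs in `Out`. Classical control is the branching of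
the tree; classical computation is free, only `query` touches the input.

* `halt a`: stop and output `a`;
* `prepare φ P`: discard the register, set it to the unit vector `φ`, continue with `P`;
* `unitary U P`: apply a unitary that does not depend on the input;
* `query P`: one query to the input matrix, `|i, j, b, a⟩ ↦ |i, j, b ⊕ M i j, a⟩`;
* `measure f P`: measure the value of `f` in the computational basis (`f = id` is the complete
  measurement), and continue with `P x` on the result `x`. -/
inductive QProg (n : ℕ) (A : Type) [Fintype A] (Out : Type) : Type
  | halt (a : Out) : QProg n A Out
  | prepare (φ : Metric.sphere (0 : QState n A) 1) (P : QProg n A Out) : QProg n A Out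
  | unitary (U : QState n A ≃ₗᵢ[ℂ] QState n A) (P : QProg n A Out) : QProg n A Out
  | query (P : QProg n A Out) : QProg n A Out
  | measure (f : QBasis n A → QBasis n A) (P : QBasis n A → QProg n A Out) : QProg n A Out

namespace QProg

variable {n : ℕ} {A : Type} [Fintype A] {Out Out' : Type}

open Classical in
/-- Projection onto the span of the basis states `y` with `f y = x`. -/
noncomputable def project (f : QBasis n A → QBasis n A) (x : QBasis n A) (ψ : QState n A) :
    QState n A :=
  WithLp.toLp 2 fun y => if f y = x then ψ y else 0

open Classical in
/-- Probability that the program, run on input `M`, outputs `b`, multiplied by the squared norm of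
the state `ψ` that it starts in. -/
noncomputable def weight (M : Matrix (Fin n) (Fin n) Bool) (b : Out) :
    QProg n A Out → QState n A → ℝ
  | halt a, ψ => if a = b then ‖ψ‖ ^ 2 else 0
  | prepare φ P, ψ => weight M b P ((‖ψ‖ : ℂ) • (φ : QState n A))
  | unitary U P, ψ => weight M b P (U ψ)
  | query P, ψ => weight M b P (queryUnitary M ψ)
  | measure f P, ψ => ∑ x, weight M b (P x) (project f x ψ)

/-- Expected number of queries on input `M`, multiplied by the squared norm of the state `ψ` that
the program starts in. -/
noncomputable def queryWeight (M : Matrix (Fin n) (Fin n) Bool) :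
    QProg n A Out → QState n A → ℝ
  | halt _, _ => 0
  | prepare φ P, ψ => queryWeight M P ((‖ψ‖ : ℂ) • (φ : QState n A))
  | unitary U P, ψ => queryWeight M P (U ψ)
  | query P, ψ => ‖ψ‖ ^ 2 + queryWeight M P (queryUnitary M ψ)
  | measure f P, ψ => ∑ x, queryWeight M (P x) (project f x ψ)

open Classical in
/-- The initial state `|0, 0, 0, default⟩`. -/
noncomputable def initial [NeZero n] [Inhabited A] : QState n A :=
  EuclideanSpace.single (0, 0, false, default) 1

/-- Probability that the program outputs `b` on input `M`. -/
noncomputable def prob [NeZero n] [Inhabited A] (P : QProg n A Out)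
    (M : Matrix (Fin n) (Fin n) Bool) (b : Out) : ℝ :=
  weight M b P initial

/-- Expected number of queries of the program on input `M`. -/
noncomputable def expQueries [NeZero n] [Inhabited A] (P : QProg n A Out)
    (M : Matrix (Fin n) (Fin n) Bool) : ℝ :=
  queryWeight M P initial

/-- Worst-case number of queries: the largest number of queries along a branch. -/
def maxQueries : QProg n A Out → ℕ
  | halt _ => 0
  | prepare _ P => maxQueries P
  | unitary _ P => maxQueries P
  | query P => maxQueries P + 1
  | measure _ P => Finset.univ.sup fun x => maxQueries (P x)

/-- Classical post-processing of the output. -/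
def map (g : Out → Out') : QProg n A Out → QProg n A Out'
  | halt a => halt (g a)
  | prepare φ P => prepare φ (map g P)
  | unitary U P => unitary U (map g P)
  | query P => query (map g P)
  | measure f P => measure f fun x => map g (P x)

end QProg

namespace Learning

/-! ### Grover search with a known number of solutions -/

/-- `(n √2)⁻¹ ∑_{i,j} |i, j⟩ (|0⟩ - |1⟩)`. -/
noncomputable def startVec (n : ℕ) : QState n Unit :=
  WithLp.toLp 2 fun x => (if x.2.2.1 then -1 else 1) * (((n : ℝ) * √2)⁻¹ : ℝ)

theorem norm_startVec (n : ℕ) [NeZero n] : ‖startVec n‖ = 1 := by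
  have hn : (n : ℝ) ≠ 0 := Nat.cast_ne_zero.2 (NeZero.ne n)
  have h : ‖startVec n‖ ^ 2 = 1 := by
    rw [EuclideanSpace.norm_sq_eq]
    have hx : ∀ x : QBasis n Unit, ‖startVec n x‖ ^ 2 = ((n : ℝ) ^ 2 * 2)⁻¹ := by
      rintro ⟨i, j, b, u⟩
      have h2 : (√2 : ℝ) ^ 2 = 2 := Real.sq_sqrt (by norm_num)
      have hc : ‖startVec n (i, j, b, u)‖ = ‖(((n : ℝ) * √2)⁻¹ : ℝ)‖ := by
        simp only [startVec]
        rw [norm_mul, Complex.norm_real]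
        cases b <;> simp
      rw [hc, Real.norm_eq_abs, sq_abs, inv_pow, mul_pow, h2]
    rw [Finset.sum_congr rfl fun x _ => hx x]
    simp only [Finset.sum_const, Finset.card_univ, Fintype.card_prod, Fintype.card_fin,
      Fintype.card_bool, Fintype.card_unit, nsmul_eq_mul]
    push_cast
    field_simp
  nlinarith [norm_nonneg (startVec n)]

noncomputable def startState (n : ℕ) [NeZero n] : Metric.sphere (0 : QState n Unit) 1 :=
  ⟨startVec n, by simp [norm_startVec]⟩

noncomputable def basisState {n : ℕ} (x : QBasis n Unit) : Metric.sphere (0 : QState n Unit) 1 :=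
  ⟨EuclideanSpace.single x 1, by simp⟩

/-- The 0/1 matrix `M'` whose one-entries are the pairs in `L`. -/
def matrixOf {n : ℕ} (L : Finset (Fin n × Fin n)) : Matrix (Fin n) (Fin n) Bool :=
  Matrix.of fun i j => decide ((i, j) ∈ L)

/-- `r` Grover iterations, then `P`. Since the target bit is in the state `|0⟩ - |1⟩`, the query to
`M` followed by the (query-free) unitary for `M'` changes the sign of those `|i, j⟩` with
`M i j ≠ M' i j`; the last unitary is the reflection `2 |s⟩⟨s| - 1` about the start vector. -/
noncomputable def groverIterate {n : ℕ} {Out : Type} (L : Finset (Fin n × Fin n)) :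
    ℕ → QProg n Unit Out → QProg n Unit Out
  | 0, P => P
  | r + 1, P => .query (.unitary (queryUnitary (matrixOf L))
      (.unitary (Submodule.reflection (Submodule.span ℂ {startVec n})) (groverIterate L r P)))

/-- Number of Grover iterations for `t` solutions in a search space of size `N`. -/
noncomputable def groverRounds (N t : ℕ) : ℕ :=
  ⌊Real.pi / (4 * Real.arcsin √((t : ℝ) / N))⌋₊

/-- One Grover search for `(i, j)` with `M i j = 1` and `M' i j = 0`, where `M'` is the matrix of
`L`, for `t` solutions. The pair that is measured is checked by one more query; the
program goes on with `P (some (i, j))` if it is a solution and with `P none` otherwise. -/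
noncomputable def groverSearch {n : ℕ} [NeZero n] {Out : Type} (t : ℕ)
    (L : Finset (Fin n × Fin n)) (P : Option (Fin n × Fin n) → QProg n Unit Out) :
    QProg n Unit Out :=
  .prepare (startState n) <| groverIterate L (groverRounds (n ^ 2) t) <|
    .measure id fun x => .prepare (basisState (x.1, x.2.1, false, ())) <|
      .query <| .measure id fun y =>
        if y.2.2.1 = true ∧ (x.1, x.2.1) ∉ L then P (some (x.1, x.2.1)) else P none

/-- Number of queries of one such search. -/
noncomputable def searchCost (n t : ℕ) : ℕ := groverRounds (n ^ 2) t + 1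

/-! ### Learning the adjacency matrix -/

/-- The learning loop with `t` one-entries still to be found and those in `L` known: search,
repeatedly, until a solution is found, add it to `L`, and go on with `t - 1`. It is stopped, with
output `none`, as soon as the next search would exceed the budget of `B` queries. -/
noncomputable def learnLoop {n : ℕ} [NeZero n] (B t : ℕ) (L : Finset (Fin n × Fin n)) :
    QProg n Unit (Option (Finset (Fin n × Fin n))) :=
  match t with
  | 0 => .halt (some L)
  | t + 1 =>
    if searchCost n (t + 1) ≤ B then
      groverSearch (t + 1) L fun
        | some e => learnLoop (B - searchCost n (t + 1)) t (insert e L)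
        | none => learnLoop (B - searchCost n (t + 1)) (t + 1) L
    else .halt none
termination_by B
decreasing_by all_goals (simp only [searchCost] at *; omega)

/-- Learning an `n × n` matrix with `m` one-entries, stopped at `B` queries. -/
noncomputable def learn (n : ℕ) [NeZero n] (m B : ℕ) :
    QProg n Unit (Option (Finset (Fin n × Fin n))) :=
  learnLoop B m ∅

/-- Expected number of queries of the learning algorithm without stopping: the limit, as the budget
grows, of the (increasing) expected numbers of queries of the stopped algorithms. -/
noncomputable def expectedCost (n : ℕ) [NeZero n] (m : ℕ) (M : Matrix (Fin n) (Fin n) Bool) :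
    ENNReal :=
  ⨆ B : ℕ, ENNReal.ofReal ((learn n m B).expQueries M)

/-! ### Graphs, and the classical last step -/

/-- The edges of the graph with adjacency matrix `M`. -/
def edges {n : ℕ} (M : Matrix (Fin n) (Fin n) Bool) : Finset (Fin n × Fin n) :=
  Finset.univ.filter fun e => M e.1 e.2 = true

/-- All vertices have out-degree `k`. -/
def HasOutDegree {n : ℕ} (M : Matrix (Fin n) (Fin n) Bool) (k : ℕ) : Prop :=
  ∀ i, (Finset.univ.filter fun j => M i j = true).card = k

/-- From every vertex there is a path to every other one: connectivity for undirected graphs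
(symmetric `M`), strong connectivity for directed ones. -/
def IsConnected {n : ℕ} (M : Matrix (Fin n) (Fin n) Bool) : Prop :=
  ∀ s t, Relation.ReflTransGen (fun i j => M i j = true) s t

/-- One round of breadth-first search along the edges in `L`. -/
def grow {n : ℕ} (L : Finset (Fin n × Fin n)) (S : Finset (Fin n)) : Finset (Fin n) :=
  S ∪ (L.filter fun e => e.1 ∈ S).image Prod.snd

/-- The breadth-first tree with root `0` spans all vertices. -/
def spans {n : ℕ} [NeZero n] (L : Finset (Fin n × Fin n)) : Bool :=
  decide ((grow L)^[n] {0} = Finset.univ)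

/-- The classical decision from the edges: vertex `0` reaches all vertices, and is reached
by all of them (for undirected graphs the second test repeats the first). -/
def classicalAnswer {n : ℕ} [NeZero n] (L : Finset (Fin n × Fin n)) : Bool :=
  spans L && spans (L.image Prod.swap)

/-- Deciding connectivity: learn the matrix, then compute the answer classically;
`none` if the learning was stopped. -/
noncomputable def decideConnectivity (n : ℕ) [NeZero n] (m B : ℕ) : QProg n Unit (Option Bool) :=
  (learn n m B).map (Option.map classicalAnswer)

end Learning

open Learning

/-! With the target bit in `|0⟩ - |1⟩`, the query to `M` followed by the unitary for `M'` flips the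
sign of exactly the missing entries. Grover iterations therefore keep one common amplitude on the
missing entries and one on all other pairs, and each rotates this plane by `2θ`, where `sin² θ = t /
n²`. A search thus acts like a classical coin toss with fixed cost `searchCost n t` and success
probability `successProb n t` (`payoff_groverSearch`), and the whole loop becomes a classical
recursion in the budget and the number of missing entries alone (`payoff_learnLoop`).

Rounding the number of iterations down leaves the final angle within `θ` of `π/2` when `t ≤ n²/2`,
and no iteration is made when more than half of the pairs are solutions; either way the coin
succeeds with probability at least `1/2` (`half_le_successProb`). So twice the sum of the single
search costs bounds the expected total (`learnCost_le`); each cost is at most `2n/√t`, and the sum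
of `1/√t` telescopes to at most `2√m`.

A run that gives up at budget `B` would have made more than `B` queries if continued, so Markov's
inequality bounds the probability of giving up by the expectation over `B + 1` (`markov_learn`).
This yields the limit, and success `1/2` and `2/3` at two and three times the bound. Wrong results
have probability zero because every pair is checked by a query before it is added, so `m` successes
produce precisely the edge set. -/

namespace QProg

/-! ### Expected payoffs of query programs. -/

variable {n : ℕ} {A : Type} [Fintype A] {Out Out' : Type}

/-- Expected payoff, multiplied by the squared norm of the starting state: a run earns `h a` for the
output `a` and `κ` for each query. It generalises `weight` and `queryWeight`. -/
noncomputable def payoff (M : Matrix (Fin n) (Fin n) Bool) (h : Out → ℝ) (κ : ℝ) :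
    QProg n A Out → QState n A → ℝ
  | halt a, ψ => h a * ‖ψ‖ ^ 2
  | prepare φ P, ψ => payoff M h κ P ((‖ψ‖ : ℂ) • (φ : QState n A))
  | unitary U P, ψ => payoff M h κ P (U ψ)
  | query P, ψ => κ * ‖ψ‖ ^ 2 + payoff M h κ P (queryUnitary M ψ)
  | measure f P, ψ => ∑ x, payoff M h κ (P x) (project f x ψ)

open Classical in
theorem weight_eq_payoff (M : Matrix (Fin n) (Fin n) Bool) (b : Out) (P : QProg n A Out)
    (ψ : QState n A) : weight M b P ψ = payoff M (fun a => if a = b then 1 else 0) 0 P ψ := by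
  induction P generalizing ψ with
  | halt a => by_cases h : a = b <;> simp [weight, payoff, h]
  | prepare φ P ih => simp only [weight, payoff, ih]
  | unitary U P ih => simp only [weight, payoff, ih]
  | query P ih => simp only [weight, payoff, ih, zero_mul, zero_add]
  | measure f P ih => simp only [weight, payoff, ih]

theorem queryWeight_eq_payoff (M : Matrix (Fin n) (Fin n) Bool) (P : QProg n A Out)
    (ψ : QState n A) : queryWeight M P ψ = payoff M (fun _ => 0) 1 P ψ := by
  induction P generalizing ψ with
  | halt a => simp [queryWeight, payoff]
  | prepare φ P ih => simp only [queryWeight, payoff, ih]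
  | unitary U P ih => simp only [queryWeight, payoff, ih]
  | query P ih => simp only [queryWeight, payoff, ih, one_mul]
  | measure f P ih => simp only [queryWeight, payoff, ih]

theorem payoff_map (M : Matrix (Fin n) (Fin n) Bool) (h : Out' → ℝ) (κ : ℝ) (g : Out → Out')
    (P : QProg n A Out) (ψ : QState n A) :
    payoff M h κ (P.map g) ψ = payoff M (h ∘ g) κ P ψ := by
  induction P generalizing ψ with
  | halt a => rfl
  | prepare φ P ih => simp only [map, payoff, ih]
  | unitary U P ih => simp only [map, payoff, ih]
  | query P ih => simp only [map, payoff, ih]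
  | measure f P ih => simp only [map, payoff, ih]

theorem maxQueries_map (g : Out → Out') (P : QProg n A Out) :
    (P.map g).maxQueries = P.maxQueries := by
  induction P with
  | halt a => rfl
  | prepare φ P ih => simp only [map, maxQueries, ih]
  | unitary U P ih => simp only [map, maxQueries, ih]
  | query P ih => simp only [map, maxQueries, ih]
  | measure f P ih => simp only [map, maxQueries, ih]

omit [Fintype A] in
theorem project_zero (f : QBasis n A → QBasis n A) (x : QBasis n A) :
    project f x (0 : QState n A) = 0 := by
  ext y
  simp [project]

/-- Branches of amplitude zero contribute nothing, whatever program follows them; this discards the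
impossible outcomes of a measurement. -/
theorem payoff_zero (M : Matrix (Fin n) (Fin n) Bool) (h : Out → ℝ) (κ : ℝ)
    (P : QProg n A Out) : payoff M h κ P 0 = 0 := by
  induction P with
  | halt a => simp [payoff]
  | prepare φ P ih => simp [payoff, ih]
  | unitary U P ih => simp [payoff, ih]
  | query P ih => simp [payoff, ih]
  | measure f P ih => simp [payoff, project_zero, ih]

omit [Fintype A] in
theorem project_id [DecidableEq (QBasis n A)] (x : QBasis n A) (ψ : QState n A) :
    project id x ψ = EuclideanSpace.single x (ψ x) := by
  ext y
  by_cases h : y = x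
  · subst h; simp [project]
  · simp [project, h]

theorem queryUnitary_apply (M : Matrix (Fin n) (Fin n) Bool) (ψ : QState n A) (x : QBasis n A) :
    queryUnitary M ψ x = ψ (x.1, x.2.1, xor x.2.2.1 (M x.1 x.2.1), x.2.2.2) := rfl

theorem queryUnitary_single [DecidableEq (QBasis n A)] (M : Matrix (Fin n) (Fin n) Bool) (i j : Fin n) (b : Bool) (a : A)
    (z : ℂ) : queryUnitary M (EuclideanSpace.single (i, j, b, a) z) =
      EuclideanSpace.single (i, j, xor b (M i j), a) z := by
  simp [queryUnitary, queryPerm]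

/-- A complete measurement of a multiple of a basis state. -/
theorem payoff_measure_id_single [DecidableEq (QBasis n A)] (M : Matrix (Fin n) (Fin n) Bool) (h : Out → ℝ)
    (κ : ℝ) (P : QBasis n A → QProg n A Out) (x : QBasis n A) (z : ℂ) :
    payoff M h κ (measure id P) (EuclideanSpace.single x z) =
      payoff M h κ (P x) (EuclideanSpace.single x z) := by
  simp only [payoff, project_id]
  rw [Finset.sum_eq_single x]
  · simp
  · intro y _ hy
    have h0 : (EuclideanSpace.single x z : QState n A) y = 0 := by simp [hy]
    have h1 : (EuclideanSpace.single y 0 : QState n A) = 0 := by simp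
    rw [h0, h1, payoff_zero]
  · simp

end QProg

/-! ### Grover iterations as rotations of a plane. -/

namespace Learning

open QProg

variable {n : ℕ} {Out : Type}

/-- The state after `r` Grover iterations. -/
noncomputable def groverState (M : Matrix (Fin n) (Fin n) Bool) (L : Finset (Fin n × Fin n)) :
    ℕ → QState n Unit → QState n Unit
  | 0, ψ => ψ
  | r + 1, ψ => groverState M L r (Submodule.reflection (Submodule.span ℂ {startVec n})
      (queryUnitary (matrixOf L) (queryUnitary M ψ)))

theorem payoff_groverIterate (M : Matrix (Fin n) (Fin n) Bool) (L : Finset (Fin n × Fin n))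
    (h : Out → ℝ) (κ : ℝ) (r : ℕ) (P : QProg n Unit Out) (ψ : QState n Unit) :
    payoff M h κ (groverIterate L r P) ψ =
      r * κ * ‖ψ‖ ^ 2 + payoff M h κ P (groverState M L r ψ) := by
  induction r generalizing ψ with
  | zero => simp [groverIterate, groverState]
  | succ r ih =>
    simp only [groverIterate, groverState, payoff, ih, LinearIsometryEquiv.norm_map]
    push_cast
    ring

theorem maxQueries_groverIterate (L : Finset (Fin n × Fin n)) (r : ℕ) (P : QProg n Unit Out) :
    (groverIterate L r P).maxQueries = r + P.maxQueries := by
  induction r with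
  | zero => simp [groverIterate]
  | succ r ih =>
    simp only [groverIterate, maxQueries, ih]
    omega

theorem mem_edges {M : Matrix (Fin n) (Fin n) Bool} {e : Fin n × Fin n} :
    e ∈ edges M ↔ M e.1 e.2 = true := by simp [edges]

/-- The state with real amplitude `a` on the solutions in `S` and `c` on the other pairs, the target
bit being in the state `|0⟩ - |1⟩`, multiplied by `z`. -/
noncomputable def twoLevel (S : Finset (Fin n × Fin n)) (z : ℂ) (a c : ℝ) : QState n Unit :=
  WithLp.toLp 2 fun x => z * ((if x.2.2.1 then -1 else 1) *
    ((if (x.1, x.2.1) ∈ S then a else c : ℝ) : ℂ))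

theorem smul_startVec (S : Finset (Fin n × Fin n)) (z : ℂ) :
    z • startVec n = twoLevel S z ((n : ℝ) * √2)⁻¹ ((n : ℝ) * √2)⁻¹ := by
  ext x
  simp [startVec, twoLevel]

/-- Phase kickback: on `|0⟩ - |1⟩` each unitary contributes a sign, and since `L ⊆ edges M` the two
signs cancel on `L`. -/
theorem query_twoLevel {M : Matrix (Fin n) (Fin n) Bool} {L : Finset (Fin n × Fin n)}
    (hL : L ⊆ edges M) (z : ℂ) (a c : ℝ) :
    queryUnitary (matrixOf L) (queryUnitary M (twoLevel (edges M \ L) z a c)) =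
      twoLevel (edges M \ L) z (-a) c := by
  ext ⟨i, j, b, u⟩
  simp only [queryUnitary_apply, twoLevel, matrixOf, Matrix.of_apply, Finset.mem_sdiff, mem_edges]
  by_cases h : (i, j) ∈ L
  · have h' : M i j = true := mem_edges.1 (hL h)
    cases b <;> simp [h, h']
  · by_cases h' : M i j = true
    · cases b <;> simp [h, h']
    · cases b <;> simp [h, h']

theorem inner_startVec_twoLevel (S : Finset (Fin n × Fin n)) (z : ℂ) (a c : ℝ) :
    inner ℂ (startVec n) (twoLevel S z a c) =
      z * (((n : ℝ) * √2)⁻¹ * 2 * (S.card * a + ((n : ℝ) ^ 2 - S.card) * c) : ℝ) := by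
  have hb : ∀ i j : Fin n, ∑ y : Bool × Unit,
      inner ℂ (startVec n (i, j, y)) (twoLevel S z a c (i, j, y)) =
        z * (((n : ℝ) * √2)⁻¹ * 2 * (if (i, j) ∈ S then a else c) : ℝ) := by
    intro i j
    rw [Fintype.sum_prod_type]
    split_ifs with h <;> simp [startVec, twoLevel, h] <;> ring
  rw [PiLp.inner_apply, Fintype.sum_prod_type]
  simp only [Fintype.sum_prod_type (α₁ := Fin n) (α₂ := Bool × Unit), hb]
  rw [← Fintype.sum_prod_type' (f := fun i j =>
    z * ((((n : ℝ) * √2)⁻¹ * 2 * (if (i, j) ∈ S then a else c) : ℝ) : ℂ)),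
    ← Finset.mul_sum, ← Complex.ofReal_sum, ← Finset.mul_sum]
  congr 3
  have hs : ∀ x : Fin n × Fin n, (if (x.1, x.2) ∈ S then a else c) =
      (if x ∈ S then a - c else 0) + c := by
    intro x; split_ifs <;> simp
  rw [Finset.sum_congr rfl fun x _ => hs x, Finset.sum_add_distrib, Finset.sum_ite_mem]
  simp
  ring

/-- Inversion about the mean: each amplitude is replaced by twice the mean minus itself. -/
theorem reflection_twoLevel [NeZero n] (S : Finset (Fin n × Fin n)) (z : ℂ) (a c : ℝ) :
    Submodule.reflection (Submodule.span ℂ {startVec n}) (twoLevel S z a c) =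
      twoLevel S z
        (2 * (S.card * a + ((n : ℝ) ^ 2 - S.card) * c) / n ^ 2 - a)
        (2 * (S.card * a + ((n : ℝ) ^ 2 - S.card) * c) / n ^ 2 - c) := by
  have hn : (n : ℝ) ≠ 0 := Nat.cast_ne_zero.2 (NeZero.ne n)
  have h2 : (√2 : ℝ) * √2 = 2 := Real.mul_self_sqrt (by norm_num)
  rw [Submodule.reflection_apply, Submodule.starProjection_unit_singleton ℂ (norm_startVec n),
    inner_startVec_twoLevel]
  set q : ℝ := S.card * a + ((n : ℝ) ^ 2 - S.card) * c with hq
  have hk : ((n : ℝ) * √2)⁻¹ * 2 * q * ((n : ℝ) * √2)⁻¹ = q / n ^ 2 := by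
    field_simp
    rw [sq, h2]
  ext x
  have hv : (2 * q / (n : ℝ) ^ 2) = 2 * (((n : ℝ) * √2)⁻¹ * 2 * q * ((n : ℝ) * √2)⁻¹) := by
    rw [hk]; ring
  rw [hv]
  clear_value q
  simp only [startVec, twoLevel, PiLp.sub_apply, PiLp.smul_apply, smul_eq_mul, nsmul_eq_mul]
  by_cases h : (x.1, x.2.1) ∈ S <;> simp only [h, if_true, if_false] <;> push_cast <;> ring

end Learning
namespace Learning

open QProg

variable {n : ℕ} {Out : Type}

/-- One iteration advances the angle `φ` by `2θ`. The invariants are kept in product form, without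
dividing by `sin θ` or `cos θ`, so that the cases of no solutions and of only solutions need no
separate treatment. -/
theorem groverState_twoLevel [NeZero n] {M : Matrix (Fin n) (Fin n) Bool}
    {L : Finset (Fin n × Fin n)} (hL : L ⊆ edges M) (z : ℂ) {θ K : ℝ}
    (hθ : Real.sin θ ^ 2 = (edges M \ L).card / (n : ℝ) ^ 2) (r : ℕ) {a c φ : ℝ}
    (ha : Real.sin θ * a = K * Real.sin φ) (hc : Real.cos θ * c = K * Real.cos φ) :
    ∃ a' c' : ℝ, groverState M L r (twoLevel (edges M \ L) z a c) =
        twoLevel (edges M \ L) z a' c' ∧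
      Real.sin θ * a' = K * Real.sin (φ + 2 * r * θ) ∧
      Real.cos θ * c' = K * Real.cos (φ + 2 * r * θ) := by
  induction r generalizing a c φ with
  | zero => exact ⟨a, c, rfl, by simpa using ha, by simpa using hc⟩
  | succ r ih =>
    have hn : (n : ℝ) ≠ 0 := Nat.cast_ne_zero.2 (NeZero.ne n)
    have hcos : Real.cos θ ^ 2 = 1 - Real.sin θ ^ 2 := by rw [Real.cos_sq']
    have hm : 2 * ((edges M \ L).card * (-a) + ((n : ℝ) ^ 2 - (edges M \ L).card) * c) / n ^ 2 =
        2 * K * Real.cos (φ + θ) := by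
      have h1 : 2 * ((edges M \ L).card * (-a) + ((n : ℝ) ^ 2 - (edges M \ L).card) * c) / n ^ 2 =
          2 * (Real.cos θ ^ 2 * c - Real.sin θ ^ 2 * a) := by
        rw [hcos, hθ]; field_simp; ring
      rw [h1, Real.cos_add]
      linear_combination 2 * Real.cos θ * hc - 2 * Real.sin θ * ha
    -- Centring both angles at `φ + θ` turns the updates into sum-to-product identities.
    have hφ : φ + 2 * θ = (φ + θ) + θ := by ring
    have hφ' : φ = (φ + θ) - θ := by ring
    have hs : Real.sin θ * (2 * K * Real.cos (φ + θ) + a) = K * Real.sin (φ + 2 * θ) := by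
      have := Real.sin_sub (φ + θ) θ
      rw [← hφ'] at this
      rw [hφ, Real.sin_add (φ + θ), mul_add, ha, this]
      ring
    have hs' : Real.cos θ * (2 * K * Real.cos (φ + θ) - c) = K * Real.cos (φ + 2 * θ) := by
      have := Real.cos_sub (φ + θ) θ
      rw [← hφ'] at this
      rw [hφ, Real.cos_add (φ + θ), mul_sub, hc, this]
      ring
    obtain ⟨a', c', h, h1, h2⟩ := ih hs hs'
    refine ⟨a', c', ?_, ?_, ?_⟩
    · rw [groverState, query_twoLevel hL, reflection_twoLevel, hm, sub_neg_eq_add, h]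
    · rw [h1]; push_cast; ring_nf
    · rw [h2]; push_cast; ring_nf

/-- Success probability of a Grover search for `t` solutions in a space of size `n ^ 2`. -/
noncomputable def successProb (n t : ℕ) : ℝ :=
  Real.sin ((2 * groverRounds (n ^ 2) t + 1) * Real.arcsin √((t : ℝ) / (n ^ 2 : ℕ))) ^ 2

theorem sum_twoLevel (S : Finset (Fin n × Fin n)) (z : ℂ) (a c u v : ℝ) :
    ∑ x : QBasis n Unit, (if (x.1, x.2.1) ∈ S then u else v) * ‖twoLevel S z a c x‖ ^ 2 =
      2 * ‖z‖ ^ 2 * (S.card * (u * a ^ 2) + ((n : ℝ) ^ 2 - S.card) * (v * c ^ 2)) := by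
  have hb : ∀ i j : Fin n, ∑ y : Bool × Unit,
      (if (i, j) ∈ S then u else v) * ‖twoLevel S z a c (i, j, y)‖ ^ 2 =
        2 * ‖z‖ ^ 2 * ((if (i, j) ∈ S then u * a ^ 2 - v * c ^ 2 else 0) + v * c ^ 2) := by
    intro i j
    rw [Fintype.sum_prod_type]
    by_cases h : (i, j) ∈ S <;>
      simp [twoLevel, h, mul_pow, -Complex.ofReal_neg] <;> ring
  rw [Fintype.sum_prod_type]
  simp only [Fintype.sum_prod_type (α₁ := Fin n) (α₂ := Bool × Unit), hb]
  rw [← Fintype.sum_prod_type' (f := fun i j =>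
    2 * ‖z‖ ^ 2 * ((if (i, j) ∈ S then u * a ^ 2 - v * c ^ 2 else 0) + v * c ^ 2)),
    ← Finset.mul_sum, Finset.sum_add_distrib]
  simp only [Prod.mk.eta]
  rw [Finset.sum_ite_mem]
  simp only [Finset.univ_inter, Finset.sum_const, Finset.card_univ, Fintype.card_prod,
    Fintype.card_fin, nsmul_eq_mul]
  push_cast
  ring

/-- The continuations may only depend on the norm of the state and on whether the pair is a
solution. The loop satisfies this: it halts or prepares a fresh register, and its value is the same
for every solution found. -/
theorem payoff_groverSearch [NeZero n] {M : Matrix (Fin n) (Fin n) Bool}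
    {L : Finset (Fin n × Fin n)} (hL : L ⊆ edges M) {t : ℕ} (ht : (edges M \ L).card = t)
    (h : Out → ℝ) (κ : ℝ) (P : Option (Fin n × Fin n) → QProg n Unit Out) (u v : ℝ)
    (hu : ∀ e ∈ edges M \ L, ∀ ψ, payoff M h κ (P (some e)) ψ = u * ‖ψ‖ ^ 2)
    (hv : ∀ ψ, payoff M h κ (P none) ψ = v * ‖ψ‖ ^ 2) (ψ : QState n Unit) :
    payoff M h κ (groverSearch t L P) ψ =
      (κ * searchCost n t + successProb n t * u + (1 - successProb n t) * v) * ‖ψ‖ ^ 2 := by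
  have hn : (n : ℝ) ≠ 0 := Nat.cast_ne_zero.2 (NeZero.ne n)
  have hN : (t : ℝ) ≤ (n : ℝ) ^ 2 := by
    have h1 : (edges M \ L).card ≤ Fintype.card (Fin n × Fin n) := Finset.card_le_univ _
    simp only [Fintype.card_prod, Fintype.card_fin, ht, ← sq] at h1
    exact_mod_cast h1
  set θ : ℝ := Real.arcsin √((t : ℝ) / (n ^ 2 : ℕ)) with hθdef
  have hθ : Real.sin θ ^ 2 = (t : ℝ) / (n : ℝ) ^ 2 := by
    have h0 : 0 ≤ (t : ℝ) / (n ^ 2 : ℕ) := by positivity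
    have h1 : (t : ℝ) / (n ^ 2 : ℕ) ≤ 1 := by
      push_cast
      exact div_le_one_of_le₀ hN (by positivity)
    rw [hθdef, Real.sin_arcsin (by linarith [Real.sqrt_nonneg ((t : ℝ) / (n ^ 2 : ℕ))])
      (Real.sqrt_le_one.2 h1), Real.sq_sqrt h0]
    push_cast
    rfl
  have hK : ((n : ℝ) ^ 2) * (((n : ℝ) * √2)⁻¹) ^ 2 * 2 = 1 := by
    have h2 : (√2 : ℝ) ^ 2 = 2 := Real.sq_sqrt (by norm_num)
    rw [inv_pow, mul_pow, h2]
    field_simp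
  set r := groverRounds (n ^ 2) t with hr
  -- The uniform start vector has `a = c = K`, hence initial angle `φ = θ` and final angle `(2r +
  -- 1)θ`.
  obtain ⟨a, c, hst, ha, hc⟩ := groverState_twoLevel hL (‖ψ‖ : ℂ) (θ := θ)
    (K := ((n : ℝ) * √2)⁻¹) (by rw [ht, hθ]) r (mul_comm _ _) (mul_comm _ _)
  have hang : θ + 2 * r * θ = (2 * r + 1) * θ := by ring
  have hp : successProb n t = Real.sin (θ + 2 * r * θ) ^ 2 := by rw [hang]; rfl
  have hpa : 2 * t * a ^ 2 = successProb n t := by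
    have : (t : ℝ) = (n : ℝ) ^ 2 * Real.sin θ ^ 2 := by rw [hθ]; field_simp
    rw [hp, this]
    linear_combination 2 * (n : ℝ) ^ 2 * (Real.sin θ * a +
      ((n : ℝ) * √2)⁻¹ * Real.sin (θ + 2 * r * θ)) * ha + Real.sin (θ + 2 * r * θ) ^ 2 * hK
  have hpc : 2 * ((n : ℝ) ^ 2 - t) * c ^ 2 = 1 - successProb n t := by
    have : (n : ℝ) ^ 2 - t = (n : ℝ) ^ 2 * Real.cos θ ^ 2 := by
      rw [Real.cos_sq', hθ]; field_simp
    rw [hp, this, ← Real.cos_sq']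
    linear_combination 2 * (n : ℝ) ^ 2 * (Real.cos θ * c +
      ((n : ℝ) * √2)⁻¹ * Real.cos (θ + 2 * r * θ)) * hc + Real.cos (θ + 2 * r * θ) ^ 2 * hK
  have hnorm : ‖(‖ψ‖ : ℂ) • startVec n‖ = ‖ψ‖ := by
    rw [norm_smul, norm_startVec]; simp
  -- The checking query writes `M i j` into the fresh target bit, so the second measurement is
  -- deterministic; it adds `κ` in either case.
  have hbranch : ∀ x : QBasis n Unit,
      payoff M h κ (.prepare (basisState (x.1, x.2.1, false, ())) <| .query <| .measure id fun y =>
        if y.2.2.1 = true ∧ (x.1, x.2.1) ∉ L then P (some (x.1, x.2.1)) else P none)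
        (project id x (twoLevel (edges M \ L) (‖ψ‖ : ℂ) a c)) =
      (if (x.1, x.2.1) ∈ edges M \ L then κ + u else κ + v) *
        ‖twoLevel (edges M \ L) (‖ψ‖ : ℂ) a c x‖ ^ 2 := by
    rintro ⟨i, j, b, s⟩
    have hsm : ∀ z : ℂ, z • ((basisState ((i, j, false, ()) : QBasis n Unit) :
        Metric.sphere (0 : QState n Unit) 1) : QState n Unit) =
          EuclideanSpace.single (i, j, false, ()) z := by
      intro z
      simp only [basisState]
      ext y
      simp
    rw [payoff, payoff, hsm, queryUnitary_single, payoff_measure_id_single, project_id]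
    simp only [PiLp.norm_single, Bool.false_xor, Finset.mem_sdiff, mem_edges, Complex.norm_real,
      norm_norm]
    split_ifs with h1
    · rw [hu (i, j) (by simpa [mem_edges] using h1)]
      simp
      ring
    · rw [hv]
      simp
      ring
  rw [groverSearch, payoff, payoff_groverIterate]
  simp only [startState]
  rw [hnorm, smul_startVec (edges M \ L), hst, payoff, Finset.sum_congr rfl fun x _ => hbranch x,
    sum_twoLevel, ht]
  have hzz : ‖(‖ψ‖ : ℂ)‖ = ‖ψ‖ := by simp
  rw [hzz]
  have hcost : (searchCost n t : ℝ) = r + 1 := by simp [searchCost, hr]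
  rw [hcost]
  linear_combination ‖ψ‖ ^ 2 * (κ + u) * hpa + ‖ψ‖ ^ 2 * (κ + v) * hpc

theorem maxQueries_groverSearch_le [NeZero n] (t : ℕ) (L : Finset (Fin n × Fin n))
    (P : Option (Fin n × Fin n) → QProg n Unit Out) {b : ℕ} (hP : ∀ o, (P o).maxQueries ≤ b) :
    (groverSearch t L P).maxQueries ≤ searchCost n t + b := by
  rw [groverSearch, maxQueries, maxQueries_groverIterate, searchCost, maxQueries, add_assoc]
  gcongr
  refine Finset.sup_le fun x _ => ?_
  rw [maxQueries, maxQueries, maxQueries, add_comm]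
  gcongr
  refine Finset.sup_le fun y _ => ?_
  split_ifs <;> exact hP _

/-! ### The learning loop as a classical recursion. -/

/-- Expected payoff of `learnLoop`: `hs` is earned for the right output, `hn` for giving up, and
`κ` for each query. -/
noncomputable def loopValue (n : ℕ) (hs hn κ : ℝ) (B t : ℕ) : ℝ :=
  match t with
  | 0 => hs
  | t + 1 =>
    if searchCost n (t + 1) ≤ B then
      κ * searchCost n (t + 1) +
        successProb n (t + 1) * loopValue n hs hn κ (B - searchCost n (t + 1)) t +
        (1 - successProb n (t + 1)) * loopValue n hs hn κ (B - searchCost n (t + 1)) (t + 1)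
    else hn
termination_by B
decreasing_by all_goals (simp only [searchCost] at *; omega)

theorem payoff_learnLoop [NeZero n] {M : Matrix (Fin n) (Fin n) Bool}
    (h : Option (Finset (Fin n × Fin n)) → ℝ) (κ : ℝ) (B t : ℕ) {L : Finset (Fin n × Fin n)}
    (hL : L ⊆ edges M) (ht : (edges M \ L).card = t) (ψ : QState n Unit) :
    payoff M h κ (learnLoop B t L) ψ =
      loopValue n (h (some (edges M))) (h none) κ B t * ‖ψ‖ ^ 2 := by
  -- A failed search leaves `t` unchanged, but every search uses up at least one query of the
  -- budget.
  induction B using Nat.strong_induction_on generalizing t L ψ with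
  | _ B ih =>
    rcases t with _ | t
    · have : L = edges M := hL.antisymm (Finset.sdiff_eq_empty_iff_subset.1 (Finset.card_eq_zero.1 ht))
      rw [learnLoop, loopValue, payoff, this]
    · rw [learnLoop, loopValue]
      split_ifs with hB
      · have hlt : B - searchCost n (t + 1) < B := by
          have : 0 < searchCost n (t + 1) := Nat.succ_pos _
          omega
        refine payoff_groverSearch hL ht h κ _ _ _ (fun e he ψ => ?_) (fun ψ => ?_) ψ
        · refine ih _ hlt t (Finset.insert_subset (Finset.mem_sdiff.1 he).1 hL) ?_ ψ
          rw [Finset.sdiff_insert, Finset.card_erase_of_mem he, ht]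
          rfl
        · exact ih _ hlt (t + 1) hL ht ψ
      · rfl

theorem maxQueries_learnLoop_le [NeZero n] (B t : ℕ) (L : Finset (Fin n × Fin n)) :
    (learnLoop B t L).maxQueries ≤ B := by
  induction B using Nat.strong_induction_on generalizing t L with
  | _ B ih =>
    rcases t with _ | t
    · rw [learnLoop, maxQueries]; exact Nat.zero_le _
    · rw [learnLoop]
      split_ifs with hB
      · have hlt : B - searchCost n (t + 1) < B := by
          have : 0 < searchCost n (t + 1) := Nat.succ_pos _
          omega
        refine (maxQueries_groverSearch_le _ _ _ (b := B - searchCost n (t + 1)) ?_).trans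
          (by omega)
        rintro (_ | e)
        · exact ih _ hlt _ _
        · exact ih _ hlt _ _
      · exact Nat.zero_le _

end Learning
namespace Learning

/-! ### Correctness of breadth-first search. -/

section Classical

variable {n : ℕ}

theorem subset_grow (L : Finset (Fin n × Fin n)) (S : Finset (Fin n)) : S ⊆ grow L S :=
  Finset.subset_union_left

theorem mem_grow {L : Finset (Fin n × Fin n)} {S : Finset (Fin n)} {j : Fin n} :
    j ∈ grow L S ↔ j ∈ S ∨ ∃ i ∈ S, (i, j) ∈ L := by
  simp [grow, and_comm]

theorem reflTransGen_of_mem_iterate_grow {L : Finset (Fin n × Fin n)} {i : Fin n} (k : ℕ)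
    {j : Fin n} (h : j ∈ (grow L)^[k] {i}) :
    Relation.ReflTransGen (fun a b => (a, b) ∈ L) i j := by
  induction k generalizing j with
  | zero =>
    rw [Function.iterate_zero, id, Finset.mem_singleton] at h
    rw [h]
  | succ k ih =>
    rw [Function.iterate_succ_apply', mem_grow] at h
    rcases h with h | ⟨a, ha, hab⟩
    · exact ih h
    · exact (ih ha).tail hab

/-- Every round adds a vertex until the set is stable. With only `n` vertices, `n` rounds reach
stability. -/
theorem card_iterate_grow (L : Finset (Fin n × Fin n)) (i : Fin n) (k : ℕ) :
    k + 1 ≤ ((grow L)^[k] {i}).card ∨ grow L ((grow L)^[k] {i}) = (grow L)^[k] {i} := by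
  induction k with
  | zero => left; simp
  | succ k ih =>
    rw [Function.iterate_succ_apply']
    by_cases h : grow L ((grow L)^[k] {i}) = (grow L)^[k] {i}
    · right; rw [h, h]
    · left
      have hlt := Finset.card_lt_card ((subset_grow L ((grow L)^[k] {i})).ssubset_of_ne (Ne.symm h))
      have := ih.resolve_right h
      omega

theorem mem_iterate_grow_iff {L : Finset (Fin n × Fin n)} {i j : Fin n} :
    j ∈ (grow L)^[n] {i} ↔ Relation.ReflTransGen (fun a b => (a, b) ∈ L) i j := by
  refine ⟨reflTransGen_of_mem_iterate_grow n, fun h => ?_⟩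
  have hfix : grow L ((grow L)^[n] {i}) = (grow L)^[n] {i} := by
    refine (card_iterate_grow L i n).resolve_left fun hc => ?_
    have := Finset.card_le_univ ((grow L)^[n] {i})
    rw [Fintype.card_fin] at this
    omega
  have hroot : ∀ k, i ∈ (grow L)^[k] {i} := by
    intro k
    induction k with
    | zero => simp
    | succ k ih =>
      rw [Function.iterate_succ_apply']
      exact subset_grow L _ ih
  induction h with
  | refl => exact hroot n
  | tail _ hab ih => rw [← hfix]; exact mem_grow.2 (Or.inr ⟨_, ih, hab⟩)

theorem spans_iff [NeZero n] {L : Finset (Fin n × Fin n)} :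
    spans L = true ↔ ∀ j, Relation.ReflTransGen (fun a b => (a, b) ∈ L) 0 j := by
  simp only [spans, decide_eq_true_eq, Finset.eq_univ_iff_forall, mem_iterate_grow_iff]

/-- Any `s` reaches any `t` through vertex `0`; reaching `0` is being reached from `0` in the
reversed graph. -/
theorem classicalAnswer_edges [NeZero n] (M : Matrix (Fin n) (Fin n) Bool) :
    classicalAnswer (edges M) = true ↔ IsConnected M := by
  have hE : (fun a b : Fin n => (a, b) ∈ edges M) = fun a b => M a b = true := by
    ext a b; rw [mem_edges]
  have hS : (fun a b : Fin n => (a, b) ∈ (edges M).image Prod.swap) =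
      Function.swap fun a b => M a b = true := by
    ext a b
    simp [Function.swap, mem_edges]
  rw [classicalAnswer, Bool.and_eq_true, spans_iff, spans_iff, hE, hS]
  exact ⟨fun h s t => (Relation.reflTransGen_swap.1 (h.2 s)).trans (h.1 t),
    fun h => ⟨fun j => h 0 j, fun j => Relation.reflTransGen_swap.2 (h j 0)⟩⟩

end Classical

/-! ### Success probability, cost and Markov bounds. -/

section Estimates

theorem successProb_nonneg (n t : ℕ) : 0 ≤ successProb n t := sq_nonneg _

theorem successProb_le_one (n t : ℕ) : successProb n t ≤ 1 := Real.sin_sq_le_one _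

variable {n t : ℕ}

theorem sin_arcsin_sqrt_div (ht : t ≤ n ^ 2) :
    Real.sin (Real.arcsin √((t : ℝ) / (n ^ 2 : ℕ))) = √((t : ℝ) / (n ^ 2 : ℕ)) := by
  have h1 : (t : ℝ) / (n ^ 2 : ℕ) ≤ 1 :=
    div_le_one_of_le₀ (by exact_mod_cast ht) (Nat.cast_nonneg _)
  exact Real.sin_arcsin (by linarith [Real.sqrt_nonneg ((t : ℝ) / (n ^ 2 : ℕ))])
      (Real.sqrt_le_one.2 h1)

theorem arcsin_sqrt_div_pos (h0 : 0 < t) (ht : t ≤ n ^ 2) :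
    0 < Real.arcsin √((t : ℝ) / (n ^ 2 : ℕ)) := by
  have : 0 < n ^ 2 := h0.trans_le ht
  exact Real.arcsin_pos.2 (Real.sqrt_pos.2 (by positivity))

theorem half_le_successProb (h0 : 0 < t) (ht : t ≤ n ^ 2) : 1 / 2 ≤ successProb n t := by
  have hsin := sin_arcsin_sqrt_div ht
  have hpos := arcsin_sqrt_div_pos h0 ht
  rw [successProb]
  have hr : (groverRounds (n ^ 2) t : ℝ) ≤
      Real.pi / (4 * Real.arcsin √((t : ℝ) / (n ^ 2 : ℕ))) := Nat.floor_le (by positivity)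
  have hr' : Real.pi / (4 * Real.arcsin √((t : ℝ) / (n ^ 2 : ℕ))) <
      groverRounds (n ^ 2) t + 1 := Nat.lt_floor_add_one _
  have hle := Real.arcsin_le_pi_div_two √((t : ℝ) / (n ^ 2 : ℕ))
  have hq0 : 0 ≤ (t : ℝ) / (n ^ 2 : ℕ) := by positivity
  have hsq := Real.sq_sqrt hq0
  rw [← hsin] at hsq
  set q : ℝ := (t : ℝ) / (n ^ 2 : ℕ)
  set θ := Real.arcsin √q
  set r : ℝ := (groverRounds (n ^ 2) t : ℝ) with hrdef
  rw [le_div_iff₀ (by positivity)] at hr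
  rw [div_lt_iff₀ (by positivity)] at hr'
  have hpi := Real.pi_pos
  -- For `q ≤ 1/2`, the angle is within `θ` of `π/2`, so the probability is at least `cos² θ = 1 -
  -- q`. For `q > 1/2`, `θ > π/4` forces zero iterations and the probability is `q` itself.
  rcases le_or_gt q (1 / 2) with hq | hq
  · have h1 : Real.cos θ ≤ Real.sin ((2 * r + 1) * θ) := by
      rw [← Real.cos_sub_pi_div_two, ← Real.cos_abs (_ - _)]
      refine Real.cos_le_cos_of_nonneg_of_le_pi (abs_nonneg _) (by linarith) ?_
      rw [abs_le]
      constructor <;> nlinarith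
    have h2 : 0 ≤ Real.cos θ := Real.cos_arcsin_nonneg _
    have h3 := Real.sin_sq_add_cos_sq θ
    nlinarith
  · have hθ : Real.pi / 4 < θ := by
      by_contra hcon
      have h1 : Real.sin θ ≤ Real.sin (Real.pi / 4) :=
        Real.sin_le_sin_of_le_of_le_pi_div_two (by linarith) (by linarith) (not_lt.1 hcon)
      rw [Real.sin_pi_div_four] at h1
      have h2 : (√2 : ℝ) ^ 2 = 2 := Real.sq_sqrt (by norm_num)
      have h3 : 0 ≤ Real.sin θ := by rw [hsin]; exact Real.sqrt_nonneg _
      nlinarith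
    have hr0 : r = 0 := by
      have h1 : r < 1 := by
        by_contra hcon
        nlinarith [not_lt.1 hcon]
      have h2 : groverRounds (n ^ 2) t < 1 := by
        rw [hrdef] at h1
        exact_mod_cast h1
      rw [hrdef, Nat.lt_one_iff.1 h2, Nat.cast_zero]
    rw [hr0, mul_zero, zero_add, one_mul, hsq]
    exact hq.le

/-- From `x ≤ arcsin x` and `π ≤ 4` there are at most `n/√t` iterations; the checking query is
absorbed because `n/√t ≥ 1`. -/
theorem searchCost_le (h0 : 0 < t) (ht : t ≤ n ^ 2) :
    (searchCost n t : ℝ) ≤ 2 * (n * (√(t : ℝ))⁻¹) := by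
  have hsin := sin_arcsin_sqrt_div ht
  have hpos := arcsin_sqrt_div_pos h0 ht
  have hn : 0 < (n : ℝ) := by
    rcases Nat.eq_zero_or_pos n with rfl | h
    · omega
    · exact_mod_cast h
  have ht0 : 0 < √(t : ℝ) := Real.sqrt_pos.2 (by exact_mod_cast h0)
  have hsqrt : √((t : ℝ) / (n ^ 2 : ℕ)) = √(t : ℝ) / n := by
    rw [Real.sqrt_div (Nat.cast_nonneg _), Nat.cast_pow, Real.sqrt_sq hn.le]
  have hone : 1 ≤ n * (√(t : ℝ))⁻¹ := by
    rw [← div_eq_mul_inv, one_le_div ht0]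
    exact Real.sqrt_le_iff.2 ⟨hn.le, by exact_mod_cast ht⟩
  have hr : (groverRounds (n ^ 2) t : ℝ) ≤
      Real.pi / (4 * Real.arcsin √((t : ℝ) / (n ^ 2 : ℕ))) := Nat.floor_le (by positivity)
  have hle : √(t : ℝ) / n ≤ Real.arcsin √((t : ℝ) / (n ^ 2 : ℕ)) := by
    rw [← hsqrt]
    exact hsin.symm.trans_le (Real.sin_le hpos.le)
  have h1 : Real.pi / (4 * Real.arcsin √((t : ℝ) / (n ^ 2 : ℕ))) ≤ n * (√(t : ℝ))⁻¹ := by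
    rw [div_le_iff₀ (by positivity)]
    have h2 : n * (√(t : ℝ))⁻¹ * (√(t : ℝ) / n) = 1 := by field_simp
    have h3 : n * (√(t : ℝ))⁻¹ * (√(t : ℝ) / n) ≤
        n * (√(t : ℝ))⁻¹ * Real.arcsin √((t : ℝ) / (n ^ 2 : ℕ)) := by gcongr
    nlinarith [Real.pi_le_four]
  rw [searchCost]
  push_cast
  linarith

theorem sum_inv_sqrt_le (m : ℕ) :
    ∑ x ∈ Finset.Icc 1 m, (√(x : ℝ))⁻¹ ≤ 2 * √(m : ℝ) := by
  induction m with
  | zero => simp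
  | succ m ih =>
    rw [Finset.sum_Icc_succ_top (by omega)]
    have ha : √(m : ℝ) ^ 2 = m := Real.sq_sqrt (Nat.cast_nonneg _)
    have hb : √((m + 1 : ℕ) : ℝ) ^ 2 = m + 1 := by
      rw [Real.sq_sqrt (Nat.cast_nonneg _)]; push_cast; rfl
    have hb0 : 0 < √((m + 1 : ℕ) : ℝ) := Real.sqrt_pos.2 (by positivity)
    set a := √(m : ℝ)
    set b := √((m + 1 : ℕ) : ℝ)
    -- Since `b² - a² = 1`, `b(2b - 2a) = 1 + (b - a)²`.
    have : b⁻¹ ≤ 2 * b - 2 * a := by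
      rw [inv_le_iff_one_le_mul₀ hb0]
      nlinarith [sq_nonneg (b - a)]
    linarith

/-- Twice the sum of the costs of one search for each of `m, …, 1` solutions. -/
noncomputable def costBound (n m : ℕ) : ℝ := 2 * ∑ x ∈ Finset.Icc 1 m, (searchCost n x : ℝ)

theorem costBound_nonneg (n m : ℕ) : 0 ≤ costBound n m := by
  rw [costBound]; positivity

theorem costBound_le_sum {m : ℕ} (hm : m ≤ n ^ 2) :
    costBound n m ≤ 4 * (n * ∑ x ∈ Finset.Icc 1 m, (√(x : ℝ))⁻¹) := by
  have h : ∑ x ∈ Finset.Icc 1 m, (searchCost n x : ℝ) ≤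
      ∑ x ∈ Finset.Icc 1 m, 2 * (n * (√(x : ℝ))⁻¹) := by
    refine Finset.sum_le_sum fun x hx => ?_
    rw [Finset.mem_Icc] at hx
    exact searchCost_le hx.1 (hx.2.trans hm)
  rw [← Finset.mul_sum, ← Finset.mul_sum] at h
  rw [costBound]
  linarith

theorem costBound_le_sqrt {m : ℕ} (hm : m ≤ n ^ 2) : costBound n m ≤ 8 * (n * √(m : ℝ)) := by
  refine (costBound_le_sum hm).trans ?_
  have : (n : ℝ) * ∑ x ∈ Finset.Icc 1 m, (√(x : ℝ))⁻¹ ≤ n * (2 * √(m : ℝ)) :=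
    mul_le_mul_of_nonneg_left (sum_inv_sqrt_le m) (Nat.cast_nonneg _)
  linarith

/-- Probability that the learning loop is successful. -/
noncomputable def learnProb (n B t : ℕ) : ℝ := loopValue n 1 0 0 B t

/-- Expected number of queries of the learning loop. -/
noncomputable def learnCost (n B t : ℕ) : ℝ := loopValue n 0 0 1 B t

theorem searchCost_pos (n t : ℕ) : 0 < searchCost n t := Nat.succ_pos _

theorem loopValue_succ (n : ℕ) (hs hn κ : ℝ) (B t : ℕ) :
    loopValue n hs hn κ B (t + 1) = if searchCost n (t + 1) ≤ B then
      κ * searchCost n (t + 1) +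
        successProb n (t + 1) * loopValue n hs hn κ (B - searchCost n (t + 1)) t +
        (1 - successProb n (t + 1)) * loopValue n hs hn κ (B - searchCost n (t + 1)) (t + 1)
    else hn := by
  rw [loopValue]

theorem loopValue_eq (hs hn : ℝ) (B t : ℕ) :
    loopValue n hs hn 0 B t = hs * learnProb n B t + hn * (1 - learnProb n B t) := by
  unfold learnProb
  induction B using Nat.strong_induction_on generalizing t with
  | _ B ih =>
    rcases t with _ | t
    · rw [loopValue, loopValue]; ring
    · rw [loopValue_succ n hs, loopValue_succ n 1 0 0 B]
      split_ifs with hB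
      · have hlt : B - searchCost n (t + 1) < B := by
          have := searchCost_pos n (t + 1)
          omega
        rw [ih _ hlt t, ih _ hlt (t + 1)]
        ring
      · ring

theorem learnProb_le_one (B t : ℕ) : learnProb n B t ≤ 1 := by
  unfold learnProb
  induction B using Nat.strong_induction_on generalizing t with
  | _ B ih =>
    rcases t with _ | t
    · rw [loopValue]
    · rw [loopValue]
      split_ifs with hB
      · have hlt : B - searchCost n (t + 1) < B := by
          have := searchCost_pos n (t + 1)
          omega
        nlinarith [ih _ hlt t, ih _ hlt (t + 1), successProb_nonneg n (t + 1),
          successProb_le_one n (t + 1)]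
      · exact zero_le_one

theorem learnProb_nonneg (B t : ℕ) : 0 ≤ learnProb n B t := by
  unfold learnProb
  induction B using Nat.strong_induction_on generalizing t with
  | _ B ih =>
    rcases t with _ | t
    · rw [loopValue]; exact zero_le_one
    · rw [loopValue]
      split_ifs with hB
      · have hlt : B - searchCost n (t + 1) < B := by
          have := searchCost_pos n (t + 1)
          omega
        have h1 := mul_nonneg (successProb_nonneg n (t + 1)) (ih _ hlt t)
        have h2 := mul_nonneg (sub_nonneg.2 (successProb_le_one n (t + 1))) (ih _ hlt (t + 1))
        positivity
      · exact le_rfl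

theorem learnCost_nonneg (B t : ℕ) : 0 ≤ learnCost n B t := by
  unfold learnCost
  induction B using Nat.strong_induction_on generalizing t with
  | _ B ih =>
    rcases t with _ | t
    · rw [loopValue]
    · rw [loopValue]
      split_ifs with hB
      · have hlt : B - searchCost n (t + 1) < B := by
          have := searchCost_pos n (t + 1)
          omega
        have h1 := mul_nonneg (successProb_nonneg n (t + 1)) (ih _ hlt t)
        have h2 := mul_nonneg (sub_nonneg.2 (successProb_le_one n (t + 1))) (ih _ hlt (t + 1))
        positivity
      · exact le_rfl

/-- `costBound` is a supersolution of the recursion: with search cost `c` and success probability `p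
≥ 1/2`, `c + (1 - p) · 2c ≤ 2c`. -/
theorem learnCost_le {B : ℕ} (ht : t ≤ n ^ 2) : learnCost n B t ≤ costBound n t := by
  unfold learnCost
  induction B using Nat.strong_induction_on generalizing t with
  | _ B ih =>
    rcases t with _ | t
    · rw [loopValue]; exact costBound_nonneg _ _
    · rw [loopValue]
      split_ifs with hB
      · have hlt : B - searchCost n (t + 1) < B := by
          have := searchCost_pos n (t + 1)
          omega
        have hsum : costBound n (t + 1) = costBound n t + 2 * searchCost n (t + 1) := by
          rw [costBound, costBound, Finset.sum_Icc_succ_top (by omega)]; ring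
        have hp := half_le_successProb (Nat.succ_pos t) ht
        have hp1 := successProb_le_one n (t + 1)
        have h1 := mul_le_mul_of_nonneg_left (ih _ hlt (t := t) (by omega))
          (successProb_nonneg n (t + 1))
        have h2 := mul_le_mul_of_nonneg_left (ih _ hlt ht) (sub_nonneg.2 hp1)
        have h3 : (0 : ℝ) ≤ searchCost n (t + 1) := Nat.cast_nonneg _
        rw [hsum] at h2 ⊢
        nlinarith
      · exact costBound_nonneg _ _

/-- Markov's inequality: a run that gives up at budget `B` makes more than `B` queries when it is
given the budget for one more search. -/
theorem markov_learn {D : ℕ} (B : ℕ) (hD : ∀ s, 0 < s → s ≤ t → searchCost n s ≤ D) :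
    (B + 1) * (1 - learnProb n B t) ≤ learnCost n (B + D) t := by
  induction B using Nat.strong_induction_on generalizing t with
  | _ B ih =>
    rcases t with _ | t
    · rw [learnProb, learnCost, loopValue, loopValue]; simp
    · have hcD := hD (t + 1) (Nat.succ_pos t) le_rfl
      rw [learnProb, learnCost, loopValue_succ n 1 0 0 B, loopValue_succ n 0 0 1 (B + D),
        if_pos (hcD.trans (Nat.le_add_left D B))]
      change (B + 1) * (1 - ite _ (_ + _ * learnProb _ _ _ + _ * learnProb _ _ _) _) ≤
        _ + _ * learnCost _ _ _ + _ * learnCost _ _ _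
      have hp0 := successProb_nonneg n (t + 1)
      have hp1 := sub_nonneg.2 (successProb_le_one n (t + 1))
      split_ifs with hB
      · have hlt : B - searchCost n (t + 1) < B := by
          have := searchCost_pos n (t + 1)
          omega
        -- The remaining budget shrinks the factor `B + 1` by the search cost, and the cost already
        -- paid makes up for this because the probability of giving up is at most one.
        have h1 := mul_le_mul_of_nonneg_left (ih _ hlt (t := t) fun s h h' => hD s h (by omega)) hp0
        have h2 := mul_le_mul_of_nonneg_left (ih _ hlt hD) hp1
        rw [show B - searchCost n (t + 1) + D = B + D - searchCost n (t + 1) by omega] at h1 h2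
        rw [Nat.cast_sub hB] at h1 h2
        have hf1 : learnProb n (B - searchCost n (t + 1)) t ≤ 1 := learnProb_le_one _ _
        have hf2 : learnProb n (B - searchCost n (t + 1)) (t + 1) ≤ 1 := learnProb_le_one _ _
        have hc : (0 : ℝ) ≤ searchCost n (t + 1) := Nat.cast_nonneg _
        have h3 : 0 ≤ learnProb n (B - searchCost n (t + 1)) t := learnProb_nonneg _ _
        have h4 : 0 ≤ learnProb n (B - searchCost n (t + 1)) (t + 1) := learnProb_nonneg _ _
        have h5 := mul_nonneg hc (mul_nonneg hp0 h3)
        have h6 := mul_nonneg hc (mul_nonneg hp1 h4)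
        nlinarith
      -- Here the run at budget `B` gives up, while the extra `D` pays for the refused search, which
      -- alone costs at least `B + 1`.
      · have h1 := mul_nonneg hp0
          (learnCost_nonneg (n := n) (B + D - searchCost n (t + 1)) t)
        have h2 := mul_nonneg hp1
          (learnCost_nonneg (n := n) (B + D - searchCost n (t + 1)) (t + 1))
        have h3 : (B : ℝ) + 1 ≤ searchCost n (t + 1) := by exact_mod_cast not_le.1 hB
        linarith

theorem exists_markov_learn (n B t : ℕ) :
    ∃ B', (B + 1) * (1 - learnProb n B t) ≤ learnCost n B' t :=
  ⟨_, markov_learn (D := ∑ x ∈ Finset.Icc 1 t, searchCost n x) B fun _ h h' =>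
    Finset.single_le_sum (f := fun x => searchCost n x) (fun _ _ => Nat.zero_le _)
      (Finset.mem_Icc.2 ⟨h, h'⟩)⟩

theorem markov_costBound (B : ℕ) (ht : t ≤ n ^ 2) :
    (B + 1) * (1 - learnProb n B t) ≤ costBound n t := by
  obtain ⟨B', h⟩ := exists_markov_learn n B t
  exact h.trans (learnCost_le ht)

end Estimates

end Learning
-- From the recursion back to the programs.
namespace Learning

open QProg

variable {n m : ℕ} [NeZero n] {M : Matrix (Fin n) (Fin n) Bool}

theorem norm_initial : ‖(initial : QState n Unit)‖ = 1 := by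
  classical
  simp [initial]

omit [NeZero n] in
theorem card_edges_le (hM : (edges M).card = m) : m ≤ n ^ 2 := by
  have h1 : (edges M).card ≤ Fintype.card (Fin n × Fin n) := Finset.card_le_univ _
  simpa only [Fintype.card_prod, Fintype.card_fin, hM, ← sq] using h1

open Classical in
theorem prob_map_learn {Out : Type} (hM : (edges M).card = m) (B : ℕ)
    (g : Option (Finset (Fin n × Fin n)) → Out) (b : Out) :
    ((learn n m B).map g).prob M b =
      (if g (some (edges M)) = b then 1 else 0) * learnProb n B m +
        (if g none = b then 1 else 0) * (1 - learnProb n B m) := by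
  rw [prob, weight_eq_payoff, payoff_map, learn,
    payoff_learnLoop _ _ B m (Finset.empty_subset _) (by simpa using hM), norm_initial,
    loopValue_eq]
  simp

omit [NeZero n] in
theorem map_id {Out : Type} (P : QProg n Unit Out) : P.map id = P := by
  induction P with
  | halt a => rfl
  | prepare φ P ih => rw [QProg.map, ih]
  | unitary U P ih => rw [QProg.map, ih]
  | query P ih => rw [QProg.map, ih]
  | measure f P ih => rw [QProg.map]; congr 1; funext x; exact ih x

open Classical in
theorem prob_learn (hM : (edges M).card = m) (B : ℕ) (b : Option (Finset (Fin n × Fin n))) :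
    (learn n m B).prob M b =
      (if some (edges M) = b then 1 else 0) * learnProb n B m +
        (if none = b then 1 else 0) * (1 - learnProb n B m) := by
  have := prob_map_learn hM B id b
  rw [map_id] at this
  convert this <;> rfl

theorem prob_learn_edges (hM : (edges M).card = m) (B : ℕ) :
    (learn n m B).prob M (some (edges M)) = learnProb n B m := by
  rw [prob_learn hM]; simp

theorem prob_learn_wrong (hM : (edges M).card = m) (B : ℕ) {L : Finset (Fin n × Fin n)}
    (hL : L ≠ edges M) : (learn n m B).prob M (some L) = 0 := by
  rw [prob_learn hM]; simp [hL.symm]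

theorem classicalAnswer_eq {b : Bool} (hb : b = true ↔ IsConnected M) :
    classicalAnswer (edges M) = b :=
  Bool.eq_iff_iff.2 ((classicalAnswer_edges M).trans hb.symm)

theorem prob_decideConnectivity_right (hM : (edges M).card = m) (B : ℕ) {b : Bool}
    (hb : b = true ↔ IsConnected M) :
    (decideConnectivity n m B).prob M (some b) = learnProb n B m := by
  rw [decideConnectivity, prob_map_learn hM]
  simp [classicalAnswer_eq hb]

theorem prob_decideConnectivity_wrong (hM : (edges M).card = m) (B : ℕ) {b : Bool}
    (hb : ¬ (b = true ↔ IsConnected M)) : (decideConnectivity n m B).prob M (some b) = 0 := by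
  have hne : classicalAnswer (edges M) ≠ b := by
    rintro rfl
    exact hb (classicalAnswer_edges M)
  rw [decideConnectivity, prob_map_learn hM]
  simp [hne]

/-- Giving up is turned into the guess `false`, which can only add to the probability of a right
answer. -/
theorem learnProb_le_prob_map_getD (hM : (edges M).card = m) (B : ℕ) {b : Bool}
    (hb : b = true ↔ IsConnected M) :
    learnProb n B m ≤ ((decideConnectivity n m B).map fun o => o.getD false).prob M b := by
  rw [prob, weight_eq_payoff, payoff_map, decideConnectivity, payoff_map, learn,
    payoff_learnLoop _ _ B m (Finset.empty_subset _) (by simpa using hM), norm_initial,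
    loopValue_eq]
  have h := learnProb_le_one (n := n) B m
  simp only [Function.comp_apply, Option.map_some, Option.getD_some, classicalAnswer_eq hb]
  split_ifs <;> simp [h]

theorem expQueries_learn (hM : (edges M).card = m) (B : ℕ) :
    (learn n m B).expQueries M = learnCost n B m := by
  rw [expQueries, queryWeight_eq_payoff, learn,
    payoff_learnLoop _ _ B m (Finset.empty_subset _) (by simpa using hM), norm_initial,
    learnCost]
  simp

theorem maxQueries_learn_le (B : ℕ) : (learn n m B).maxQueries ≤ B :=
  maxQueries_learnLoop_le _ _ _

theorem maxQueries_decideConnectivity_le (B : ℕ) : (decideConnectivity n m B).maxQueries ≤ B := by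
  rw [decideConnectivity, maxQueries_map]
  exact maxQueries_learn_le B

theorem expectedCost_le (hM : (edges M).card = m) :
    expectedCost n m M ≤ ENNReal.ofReal (costBound n m) :=
  iSup_le fun B => ENNReal.ofReal_le_ofReal <| by
    rw [expQueries_learn hM]; exact learnCost_le (card_edges_le hM)

/-- The strict bound with `B + 1` expresses that `B` is at least twice the expectation rounded down;
Markov's inequality with `B + 1` loses nothing to the rounding. -/
theorem half_le_learnProb_of_expectedCost (hM : (edges M).card = m) {B : ℕ}
    (hB : 2 * expectedCost n m M < (B : ENNReal) + 1) : 1 / 2 ≤ learnProb n B m := by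
  obtain ⟨B', h⟩ := exists_markov_learn n B m
  have h1 : ENNReal.ofReal (learnCost n B' m) ≤ expectedCost n m M := by
    rw [← expQueries_learn hM]
    exact le_iSup (fun B : ℕ => ENNReal.ofReal ((learn n m B).expQueries M)) B'
  have h2 : ENNReal.ofReal (2 * learnCost n B' m) < ENNReal.ofReal (B + 1) := by
    rw [ENNReal.ofReal_mul zero_le_two, ENNReal.ofReal_add (Nat.cast_nonneg _) zero_le_one]
    simpa using (mul_le_mul_right h1 2).trans_lt hB
  have h3 := (ENNReal.ofReal_lt_ofReal_iff (by positivity)).1 h2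
  have h4 : (0 : ℝ) < B + 1 := by positivity
  by_contra hcon
  nlinarith [mul_pos h4 (sub_pos.2 (not_le.1 hcon))]

omit [NeZero n] in
theorem tendsto_learnProb (hm : m ≤ n ^ 2) :
    Filter.Tendsto (fun B : ℕ => learnProb n B m) Filter.atTop (nhds 1) := by
  have h : Filter.Tendsto (fun B : ℕ => 1 - costBound n m * (1 / ((B : ℝ) + 1))) Filter.atTop
      (nhds 1) := by
    simpa using (tendsto_one_div_add_atTop_nhds_zero_nat.const_mul (costBound n m)).const_sub 1
  refine tendsto_of_tendsto_of_tendsto_of_le_of_le h tendsto_const_nhds (fun B => ?_)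
    fun B => learnProb_le_one B m
  have h1 := markov_costBound B hm
  have h4 : (0 : ℝ) < B + 1 := by positivity
  rw [mul_comm, ← le_div_iff₀ h4] at h1
  simp only [mul_one_div]
  linarith

omit [NeZero n] in
/-- A budget of `c` times the cost bound suffices for a success probability of `1 - 1 / c`. -/
theorem le_learnProb_floor (hm : m ≤ n ^ 2) {c : ℝ} (hc : 0 < c) :
    1 - 1 / c ≤ learnProb n ⌊c * costBound n m⌋₊ m := by
  have h1 := markov_costBound (n := n) ⌊c * costBound n m⌋₊ hm
  have h2 : c * costBound n m < ⌊c * costBound n m⌋₊ + 1 := Nat.lt_floor_add_one _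
  have h3 : (0 : ℝ) < ⌊c * costBound n m⌋₊ + 1 := by positivity
  have h4 := mul_le_mul_of_nonneg_left h1 hc.le
  by_contra hcon
  have h5 : 1 / c < 1 - learnProb n ⌊c * costBound n m⌋₊ m := by linarith
  rw [div_lt_iff₀ hc] at h5
  nlinarith [mul_lt_mul_of_pos_left h5 h3]

omit [NeZero n] in
theorem floor_costBound_le (hm : m ≤ n ^ 2) {c : ℝ} (hc : 0 ≤ c) :
    (⌊c * costBound n m⌋₊ : ℝ) ≤ 8 * c * (n * √(m : ℝ)) := by
  refine (Nat.floor_le (mul_nonneg hc (costBound_nonneg _ _))).trans ?_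
  have := mul_le_mul_of_nonneg_left (costBound_le_sqrt hm) hc
  linarith

omit [NeZero n] in
theorem card_edges_of_hasOutDegree {k : ℕ} (h : HasOutDegree M k) : (edges M).card = n * k := by
  have h1 := Finset.card_eq_sum_card_fiberwise (s := edges M) (t := Finset.univ) (f := Prod.fst)
    fun _ _ => Finset.mem_coe.2 (Finset.mem_univ _)
  have h2 : ∀ i : Fin n, ((edges M).filter fun e => e.1 = i).card = k := by
    intro i
    rw [← h i]
    refine Finset.card_nbij' Prod.snd (fun j => (i, j)) ?_ ?_ ?_ ?_
    · rintro ⟨a, b⟩ hab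
      simp only [Finset.coe_filter, Set.mem_ofPred_eq, mem_edges] at hab ⊢
      obtain ⟨hab, rfl⟩ := hab
      simpa using hab
    · intro j hj
      simpa [mem_edges] using hj
    · rintro ⟨a, b⟩ hab
      simp only [Finset.coe_filter, Set.mem_ofPred_eq, mem_edges] at hab
      rw [← hab.2]
    · intro j _
      rfl
  rw [h1, Finset.sum_congr rfl fun i _ => h2 i]
  simp

end Learning

theorem mainTheorem6 :
    ∃ C : ℝ, 0 < C ∧
      -- the algorithm, for matrices with `m` one-entries
      (∀ (n : ℕ) [NeZero n] (m : ℕ) (M : Matrix (Fin n) (Fin n) Bool), (edges M).card = m →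
        -- expected number of queries without stopping
        expectedCost n m M ≤ ENNReal.ofReal (C * (n * ∑ x ∈ Finset.Icc 1 m, (√(x : ℝ))⁻¹)) ∧
        expectedCost n m M ≤ ENNReal.ofReal (C * (n * √(m : ℝ))) ∧
        -- without stopping, it learns the matrix with probability one
        Filter.Tendsto (fun B : ℕ => (learn n m B).prob M (some (edges M))) Filter.atTop (nhds 1) ∧
        -- stopped after `B` queries, it makes at most `B` queries and never gives a wrong result
        (∀ B : ℕ, (learn n m B).maxQueries ≤ B ∧ (decideConnectivity n m B).maxQueries ≤ B ∧
          (∀ L, L ≠ edges M → (learn n m B).prob M (some L) = 0) ∧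
          (∀ b : Bool, ¬ (b = true ↔ IsConnected M) →
            (decideConnectivity n m B).prob M (some b) = 0)) ∧
        -- stopped at twice the expected number of queries (rounded down) or later, it succeeds
        -- with probability at least `1 / 2`
        (∀ B : ℕ, 2 * expectedCost n m M < (B : ENNReal) + 1 →
          1 / 2 ≤ (learn n m B).prob M (some (edges M)) ∧
          ∀ b : Bool, (b = true ↔ IsConnected M) →
            1 / 2 ≤ (decideConnectivity n m B).prob M (some b))) ∧
      -- worst case: a budget of `O(n √m)` queries that depends on `n` and `m` only
      (∀ (n : ℕ) [NeZero n] (m : ℕ), ∃ B : ℕ, (B : ℝ) ≤ C * (n * √(m : ℝ)) ∧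
        ∀ M : Matrix (Fin n) (Fin n) Bool, (edges M).card = m →
          1 / 2 ≤ (learn n m B).prob M (some (edges M)) ∧
          ∀ b : Bool, (b = true ↔ IsConnected M) →
            1 / 2 ≤ (decideConnectivity n m B).prob M (some b)) ∧
      -- connectivity for out-degree `k` is decided, with bounded error, by a quantum query
      -- algorithm with `O(n √(n k)) = O(n ^ (3 / 2) √k)` queries in the worst case
      (∀ (n : ℕ) [NeZero n] (k : ℕ), ∃ P : QProg n Unit Bool,
        (P.maxQueries : ℝ) ≤ C * (n * √((n * k : ℕ) : ℝ)) ∧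
        (P.maxQueries : ℝ) ≤ C * ((n : ℝ) ^ (3 / 2 : ℝ) * √(k : ℝ)) ∧
        ∀ M : Matrix (Fin n) (Fin n) Bool, HasOutDegree M k → (edges M).card = n * k ∧
          ∀ b : Bool, (b = true ↔ IsConnected M) → 2 / 3 ≤ P.prob M b) := by

  -- `24 = 8 · 3`: the cost bound is `8n√m`, and the largest budget used is three times it, for
  -- error `1/3`.
  refine ⟨24, by norm_num, ?_, ?_, ?_⟩
  · intro n _ m M hM
    have hm := card_edges_le hM
    refine ⟨?_, ?_, ?_, ?_, ?_⟩
    · refine (expectedCost_le hM).trans (ENNReal.ofReal_le_ofReal ?_)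
      refine (costBound_le_sum hm).trans ?_
      gcongr
      norm_num
    · refine (expectedCost_le hM).trans (ENNReal.ofReal_le_ofReal ?_)
      refine (costBound_le_sqrt hm).trans ?_
      gcongr
      norm_num
    · simp only [prob_learn_edges hM]
      exact tendsto_learnProb hm
    · exact fun B => ⟨maxQueries_learn_le B, maxQueries_decideConnectivity_le B,
        fun L hL => prob_learn_wrong hM B hL, fun b hb => prob_decideConnectivity_wrong hM B hb⟩
    · intro B hB
      have h := half_le_learnProb_of_expectedCost hM hB
      exact ⟨(prob_learn_edges hM B).symm ▸ h,
        fun b hb => (prob_decideConnectivity_right hM B hb).symm ▸ h⟩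
  · intro n _ m
    by_cases hm : m ≤ n ^ 2
    · refine ⟨⌊2 * costBound n m⌋₊, ?_, fun M hM => ?_⟩
      · refine (floor_costBound_le hm zero_le_two).trans ?_
        gcongr
        norm_num
      · have h : 1 / 2 ≤ learnProb n ⌊2 * costBound n m⌋₊ m := by
          have := le_learnProb_floor hm (zero_lt_two (α := ℝ))
          linarith
        exact ⟨(prob_learn_edges hM _).symm ▸ h,
          fun b hb => (prob_decideConnectivity_right hM _ hb).symm ▸ h⟩
    -- No matrix has more than `n²` one-entries, so any budget will do.
    · exact ⟨0, by rw [Nat.cast_zero]; positivity, fun M hM => absurd (card_edges_le hM) hm⟩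
  · intro n _ k
    have hpow : (n : ℝ) ^ (3 / 2 : ℝ) * √(k : ℝ) = n * √((n * k : ℕ) : ℝ) := by
      have hn : 0 < (n : ℝ) := Nat.cast_pos.2 (NeZero.pos n)
      rw [Nat.cast_mul, Real.sqrt_mul hn.le, ← mul_assoc, Real.sqrt_eq_rpow (n : ℝ),
        show (3 / 2 : ℝ) = 1 + 1 / 2 by norm_num, Real.rpow_add hn, Real.rpow_one]
    rw [hpow]
    simp only [← and_assoc, and_self]
    by_cases hm : n * k ≤ n ^ 2
    · refine ⟨(decideConnectivity n (n * k) ⌊3 * costBound n (n * k)⌋₊).map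
        fun o => o.getD false, ?_, fun M hM => ⟨card_edges_of_hasOutDegree hM, fun b hb => ?_⟩⟩
      · rw [QProg.maxQueries_map]
        refine (Nat.cast_le.2 (maxQueries_decideConnectivity_le _)).trans ?_
        refine (floor_costBound_le hm zero_le_three).trans ?_
        gcongr
        norm_num
      · refine le_trans ?_ (learnProb_le_prob_map_getD (card_edges_of_hasOutDegree hM) _ hb)
        have := le_learnProb_floor hm (zero_lt_three (α := ℝ))
        linarith
    · refine ⟨.halt false, ?_, fun M hM =>
        absurd (card_edges_le (card_edges_of_hasOutDegree hM)) hm⟩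
      rw [QProg.maxQueries, Nat.cast_zero]
      positivity
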